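/- Write points of $\mathbb{R}^{2n}$ as $x=(q,p)$ with $q,p\in\mathbb{R}^n$, and let $J=\begin{pmatrix}0&I_n\\-I_n&0\end{pmatrix}$. Let $H\in C^2(\mathbb{R}^{2n})$ and let $\Phi^t=(\mathbf Q,\mathbf P)$, $t\ge 0$, be the (possibly only locally defined) flow of $\dot x=J\nabla H(x)$. Let $D(t;x)=\partial \mathbf P/\partial p\,(x)\in\mathbb{R}^{n\times n}$ be the lower right block of the Jacobian of $\Phi^t$ at $x$, and let $\Psi(x)=(q,\mathbf P(q,p))$ for $x=(q,p)$. Call $(U,\psi)$ a $(q,P)$-chart for $\Phi^{t}$ if $U\subset\mathbb{R}^{2n}$ is open, $\Phi^{t}$ is defined on $U$, $\psi=\Psi$ on $U$, and $\psi$ is a $C^1$-diffeomorphism of $U$ onto the open set $\psi(U)$. Let $K\subset\mathbb{R}^{2n}$ be nonempty and compact, let $T\in(0,\infty]$, and suppose that $K$ is forward invariant for times in $[0,T]$ (in $[0,\infty)$ if $T=\infty$), i.e. $\Phi^t$ is defined on $K$ and $\Phi^t(K)\subset K$ for all these $t$. Put $L_K=\sup_{y\in K}\|\nabla^2H(y)\|_2$.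 Then $L_K<\infty$, and for every $\Delta T$ with $0\le\Delta T<\min\{T,\log 2/L_K\}$ (where $\log 2/L_K=+\infty$ if $L_K=0$): (a) for all $x\in K$, $\Phi^{\Delta T}$ is differentiable at $x$ and $D(\Delta T;x)$ is invertible; (b) every $x\in K$ lies in the domain $U$ of a $(q,P)$-chart $(U,\psi)$ for $\Phi^{\Delta T}$ with simply connected image $\psi(U)$; (c) for every $(q,P)$-chart $(U,\psi)$ for $\Phi^{\Delta T}$ such that $U\cap K\ne\emptyset$ and $W:=\psi(U)$ is simply connected, the assumptions for the existence of a generating function hold, namely $D(\Delta T;x)$ is invertible for all $x\in U$ and $\Psi$ is a $C^1$-diffeomorphism of $U$ onto the simply connected open set $W$. Moreover there are functions $\mathbf p,\mathbf Q\in C^1(W,\mathbb{R}^n)$ and $S:W\to\mathbb{R}$ with $\mathbf p(\Psi(x))=p$ and $\mathbf Q(\Psi(x))=Q$ for all $x=(q,p)\in U$, where $\Phi^{\Delta T}(x)=(Q,P)$, such that $S$ is differentiable on $W$ with $$\partial_qS(q,P)=\mathbf p(q,P),\qquad \partial_PS(q,P)=\mathbf Q(q,P)\qquad\text{for all }(q,P)\in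 W,$$ and, if $\Delta T>0$, the function $S^{\Delta T}(q,P)=\frac1{\Delta T}\bigl(S(q,P)-q^\top P\bigr)$ satisfies, for all $x\in U$ (in particular for all $x\in U\cap K$), $$J^\top\,\frac{\Phi^{\Delta T}(x)-x}{\Delta T}=\nabla S^{\Delta T}\bigl(\Psi(x)\bigr).$$ -/

import Mathlib

open Set

noncomputable section

/-- Configuration (or momentum) space `ℝⁿ` with the Euclidean norm. -/
abbrev Config (n : ℕ) : Type := EuclideanSpace ℝ (Fin n)

/-- Phase space `ℝ²ⁿ` with the Euclidean norm; for `x = (q, p)` the coordinates `x (Sum.inl i)`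
are those of `q` and the coordinates `x (Sum.inr i)` are those of `p`. -/
abbrev Phase (n : ℕ) : Type := EuclideanSpace ℝ (Fin n ⊕ Fin n)

variable {n : ℕ}

/-- The `q`-part of a phase point. -/
def qPart (x : Phase n) : Config n := WithLp.toLp 2 fun i => x (Sum.inl i)

/-- The `p`-part of a phase point. -/
def pPart (x : Phase n) : Config n := WithLp.toLp 2 fun i => x (Sum.inr i)

/-- The phase point `(q, p)`. -/
def mkPhase (q p : Config n) : Phase n := WithLp.toLp 2 (Sum.elim q p)

/-- The canonical symplectic matrix `J`, i.e. `(a, b) ↦ (b, -a)`. -/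
def sympJ (x : Phase n) : Phase n := mkPhase (pPart x) (-qPart x)

/-- The transpose of `J`, i.e. `(a, b) ↦ (-b, a)`. -/
def sympJT (x : Phase n) : Phase n := mkPhase (-pPart x) (qPart x)

/-- The Hamiltonian vector field `J ∇H`. -/
def hamField (H : Phase n → ℝ) (x : Phase n) : Phase n := sympJ (gradient H x)

/-- The Hessian `∇²H(x)`, as a linear operator on phase space (so that its norm is the
spectral norm). -/
def hessian (H : Phase n → ℝ) (x : Phase n) : Phase n →L[ℝ] Phase n :=
  fderiv ℝ (gradient H) x

/-- `L_K = sup_{y ∈ K} ‖∇²H(y)‖₂`. -/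
def hessianSup (H : Phase n → ℝ) (K : Set (Phase n)) : ℝ :=
  sSup ((fun y => ‖hessian H y‖) '' K)

/-- `γ` solves `ẋ = J ∇H(x)` on the time interval `[0, t]` and starts at `x`. -/
def IsTrajectory (H : Phase n → ℝ) (x : Phase n) (t : ℝ) (γ : ℝ → Phase n) : Prop :=
  γ 0 = x ∧ IsIntegralCurveOn γ (fun _ => hamField H) (Icc 0 t)

/-- The domain of the time-`t` flow map (`t ≥ 0`): the initial points whose solution exists
on all of `[0, t]`. -/
def flowDomain (H : Phase n → ℝ) (t : ℝ) : Set (Phase n) :=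
  {x | ∃ γ, IsTrajectory H x t γ}

open Classical in
/-- The time-`t` flow map `Φᵗ` of `ẋ = J ∇H(x)` for `t ≥ 0`; it is only meaningful on
`flowDomain H t`. -/
def flow (H : Phase n → ℝ) (t : ℝ) (x : Phase n) : Phase n :=
  if h : ∃ γ, IsTrajectory H x t γ then h.choose t else x

/-- `K` is forward invariant for the times in `[0, T]` (in `[0, ∞)` if `T = ∞`):
the flow is defined on `K` and `Φᵗ(K) ⊆ K`. -/
def ForwardInvariant (H : Phase n → ℝ) (T : EReal) (K : Set (Phase n)) : Prop :=
  ∀ t : ℝ, 0 ≤ t → (t : EReal) ≤ T → K ⊆ flowDomain H t ∧ MapsTo (flow H t) K K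

open Classical in
/-- `min {T, log 2 / L}`, with `log 2 / L` read as `+∞` for `L = 0`. -/
def stepThreshold (T : EReal) (L : ℝ) : EReal :=
  min T (if L = 0 then ⊤ else ((Real.log 2 / L : ℝ) : EReal))

/-- The lower right block `D(t; x) = ∂P/∂p` of the Jacobian matrix of `Φᵗ = (Q, P)` at `x`. -/
def blockD (H : Phase n → ℝ) (t : ℝ) (x : Phase n) : Matrix (Fin n) (Fin n) ℝ :=
  Matrix.of fun i j =>
    fderiv ℝ (flow H t) x (EuclideanSpace.single (Sum.inr j) (1 : ℝ)) (Sum.inr i)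

/-- `I₁ x + I₂ y`: the `q`-part of `x` together with the `p`-part of `y`. -/
def mixed (x y : Phase n) : Phase n := mkPhase (qPart x) (pPart y)

/-- `Ψ(q, p) = (q, P(q, p)) = I₁ x + I₂ Φᵗ(x)`. -/
def mixedMap (H : Phase n → ℝ) (t : ℝ) (x : Phase n) : Phase n := mixed x (flow H t x)

/-- `f` is a `C¹` diffeomorphism of the open set `U` onto the open set `W`. -/
def IsC1Diffeo (f : Phase n → Phase n) (U W : Set (Phase n)) : Prop :=
  IsOpen U ∧ IsOpen W ∧ ContDiffOn ℝ 1 f U ∧ MapsTo f U W ∧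
    ∃ g : Phase n → Phase n, ContDiffOn ℝ 1 g W ∧ MapsTo g W U ∧
      (∀ x ∈ U, g (f x) = x) ∧ ∀ w ∈ W, f (g w) = w

/-- `(U, ψ)` is a `(q, P)`-chart for the time-`t` flow map: a `C¹` chart of phase space, on an
open set on which `Φᵗ` is defined, whose coordinates are `(q, P(q, p))`. -/
structure IsQPChart (H : Phase n → ℝ) (t : ℝ) (U : Set (Phase n))
    (ψ : Phase n → Phase n) : Prop where
  subset_domain : U ⊆ flowDomain H t
  eq_mixedMap : ∀ x ∈ U, ψ x = mixedMap H t x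
  diffeo : IsC1Diffeo ψ U (ψ '' U)

/-- The assumptions on `U` and `W` under which a generating function is sought: on the open
set `U`, where `Φᵗ` is defined, (i) `D(t; x)` is invertible, and (ii) `Ψ` is a diffeomorphism of
`U` onto the simply connected open set `W`. -/
structure GeneratingHypotheses (H : Phase n → ℝ) (t : ℝ) (U W : Set (Phase n)) : Prop where
  subset_domain : U ⊆ flowDomain H t
  invertible : ∀ x ∈ U, DifferentiableAt ℝ (flow H t) x ∧ IsUnit (blockD H t x)
  diffeo : IsC1Diffeo (mixedMap H t) U W
  simplyConnected : IsSimplyConnected W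

/-- The type II generating function `S^{ΔT}(q, P) = (S(q, P) - qᵀP) / ΔT`. -/
def typeTwo (S : Phase n → ℝ) (t : ℝ) (w : Phase n) : ℝ :=
  (S w - inner ℝ (qPart w) (pPart w)) / t

end

open scoped NNReal Topology

/-! ### Ordinary differential equations: existence, uniqueness and `C¹` dependence on the initial
point. -/

section OrdinaryDifferentialEquations

variable {E F : Type*} [NormedAddCommGroup E] [NormedSpace ℝ E]
  [NormedAddCommGroup F] [NormedSpace ℝ F] {T : ℝ}

/-! Invertibility and the generating function have separate sources. For the first, compare the
displacements `Φᵗ(y) - y` and `Φᵗ(x) - x` for `x ∈ K` and `y` near `x`. Since `J` is an isometry, a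
bound `L` on the Hessian near `K` bounds the local Lipschitz constant of the field, and Grönwall
gives `‖DΦᵗ(x) - I‖ ≤ exp (L t) - 1` (`norm_fderiv_flow_sub_id_le`). Below the threshold this is
less than `1` for some `L > L_K`. If `D p = 0`, then `DΦᵗ - I` sends `(0, p)` to a vector with
momentum part `-p`, so `‖p‖ ≤ (exp (L t) - 1) ‖p‖` and `p = 0` (`fderiv_flow_block_ker`). The
derivative of `Ψ` is block triangular with diagonal blocks `I` and `D`, so the inverse function
theorem yields the charts; conversely, being a chart forces `D` to be invertible on all of `U`.

For the second, the action `A = ∫ (⟨p, ∂H/∂p⟩ - H) ds` along trajectories satisfies `dA = P dQ - p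
dq` (`hasFDerivAt_flowAction`). Hence `S = ⟨Q, P⟩ - A`, read in the coordinates `(q, P)`, has `dS =
p dq + Q dP`. Subtracting `d(qᵀP) = P dq + q dP` leaves `(p - P, Q - q) = Jᵀ(Φ(x) - x)`.

Both parts rest on `C¹` dependence of the flow on the initial point: a cutoff reduces to a bounded
Lipschitz field, and the variational equation supplies the derivative. -/

theorem gronwallBound_zero_eq_mul (K c t : ℝ) :
    gronwallBound 0 K c t = c * gronwallBound 0 K 1 t := by
  rcases eq_or_ne K 0 with rfl | hK
  · simp [gronwallBound_K0]
  · simp only [gronwallBound_of_K_ne_0 hK]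
    ring

theorem gronwallBound_zero_nonneg {K c t : ℝ} (hK : 0 ≤ K) (hc : 0 ≤ c) (ht : 0 ≤ t) :
    0 ≤ gronwallBound 0 K c t := by
  have h := gronwallBound_mono le_rfl hc hK ht
  rwa [gronwallBound_x0] at h

/-- Converts derivatives within `[0, T]` into the right derivatives that the Grönwall and uniqueness
theorems ask for. -/
theorem HasDerivWithinAt.Ici_of_Icc {u : ℝ → F} {u' : F} {t : ℝ}
    (h : HasDerivWithinAt u u' (Icc 0 T) t) (ht : t ∈ Ico 0 T) :
    HasDerivWithinAt u u' (Ici t) t :=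
  h.mono_of_mem_nhdsWithin (Icc_mem_nhdsGE_of_mem ht)

/-- Grönwall's inequality for a function that is differentiable on `[0, T]`. -/
theorem norm_le_gronwallBound_of_hasDerivWithinAt_Icc {u u' : ℝ → F} {δ K ε : ℝ}
    (hu : ∀ t ∈ Icc 0 T, HasDerivWithinAt u (u' t) (Icc 0 T) t) (h0 : ‖u 0‖ ≤ δ)
    (bound : ∀ t ∈ Icc 0 T, ‖u' t‖ ≤ K * ‖u t‖ + ε) :
    ∀ t ∈ Icc 0 T, ‖u t‖ ≤ gronwallBound δ K ε t := by
  intro t ht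
  have h := norm_le_gronwallBound_of_norm_deriv_right_le
    (fun t ht => (hu t ht).continuousWithinAt)
    (fun t ht => (hu t (Ico_subset_Icc_self ht)).Ici_of_Icc ht) h0
    (fun t ht => bound t (Ico_subset_Icc_self ht)) t ht
  rwa [sub_zero] at h

/-- Two integral curves of a `C¹` vector field with the same initial point agree. -/
theorem IsIntegralCurveOn.eqOn_Icc_of_contDiff [FiniteDimensional ℝ E] {f : E → E}
    (hf : ContDiff ℝ 1 f) {γ η : ℝ → E} (hγ : IsIntegralCurveOn γ (fun _ => f) (Icc 0 T))
    (hη : IsIntegralCurveOn η (fun _ => f) (Icc 0 T)) (h0 : γ 0 = η 0) :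
    EqOn γ η (Icc 0 T) := by
  -- A `C¹` field is Lipschitz only locally, so both curves are first enclosed in one ball.
  have hc : IsCompact (γ '' Icc 0 T ∪ η '' Icc 0 T) :=
    (isCompact_Icc.image_of_continuousOn hγ.continuousOn).union
      (isCompact_Icc.image_of_continuousOn hη.continuousOn)
  obtain ⟨R, hR⟩ := hc.isBounded.subset_closedBall (0 : E)
  obtain ⟨K, hK⟩ := hf.contDiffOn.exists_lipschitzOnWith one_ne_zero
    (convex_closedBall (0 : E) R) (isCompact_closedBall _ _)
  exact ODE_solution_unique_of_mem_Icc_right (v := fun _ => f) (s := fun _ => Metric.closedBall 0 R)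
    (fun _ _ => hK) hγ.continuousOn
    (fun t ht => (hγ t (Ico_subset_Icc_self ht)).Ici_of_Icc ht)
    (fun t ht => hR (Or.inl (mem_image_of_mem _ (Ico_subset_Icc_self ht)))) hη.continuousOn
    (fun t ht => (hη t (Ico_subset_Icc_self ht)).Ici_of_Icc ht)
    (fun t ht => hR (Or.inr (mem_image_of_mem _ (Ico_subset_Icc_self ht)))) h0

/-- A bounded Lipschitz vector field has integral curves on every interval `[0, T]`. -/
theorem exists_isIntegralCurveOn_Icc_of_lipschitzWith_of_bounded [CompleteSpace F]
    {f : ℝ → F → F} {K L : ℝ≥0} (hT : 0 ≤ T) (hK : ∀ t ∈ Icc 0 T, LipschitzWith K (f t))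
    (hc : ∀ x, ContinuousOn (f · x) (Icc 0 T)) (hL : ∀ t ∈ Icc 0 T, ∀ x, ‖f t x‖ ≤ L) (x : F) :
    ∃ γ : ℝ → F, γ 0 = x ∧ IsIntegralCurveOn γ f (Icc 0 T) := by
  -- Speed at most `L` confines curves to the ball of radius `L * T`, so Picard–Lindelöf covers all
  -- of `[0, T]`.
  have h : IsPicardLindelof f (⟨0, left_mem_Icc.2 hT⟩ : Icc (0 : ℝ) T) x (L * T.toNNReal) 0 L K :=
    { lipschitzOnWith := fun t ht => (hK t ht).lipschitzOnWith
      continuousOn := fun y _ => hc y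
      norm_le := fun t ht y _ => hL t ht y
      mul_max_le := by simp [hT] }
  exact h.exists_eq_forall_mem_Icc_hasDerivWithinAt₀

/-- Linear differential equations on `[0, T]` are solvable. -/
theorem exists_linear_ode_solution [FiniteDimensional ℝ F] {A : ℝ → F →L[ℝ] F} (hT : 0 ≤ T)
    (hA : ContinuousOn A (Icc 0 T)) (x : F) :
    ∃ γ : ℝ → F, γ 0 = x ∧ IsIntegralCurveOn γ (fun t => A t) (Icc 0 T) := by
  have : CompleteSpace F := FiniteDimensional.complete ℝ F
  obtain ⟨C, hC⟩ := isCompact_Icc.exists_bound_of_continuousOn hA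
  have hC0 : 0 ≤ C := (norm_nonneg _).trans (hC 0 (left_mem_Icc.2 hT))
  -- Grönwall bound for a solution of the linear equation, plus `1` for positivity. Cutting off
  -- beyond `R` makes the field bounded and Lipschitz; the cutoff does not increase norms, so the
  -- solution obeys the same bound and never meets it.
  let R : ℝ := ‖x‖ * Real.exp (C * T) + 1
  have hR : 0 < R := by positivity
  let χ : ContDiffBump (0 : F) := ⟨R, R + 1, hR, by linarith⟩
  let g : F → F := fun y => χ y • y
  have hg : ContDiff ℝ 1 g := χ.contDiff.smul contDiff_id
  have hgs : HasCompactSupport g := χ.hasCompactSupport.smul_right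
  obtain ⟨K, hK⟩ := ContDiff.lipschitzWith_of_hasCompactSupport hgs hg one_ne_zero
  obtain ⟨B, hB⟩ := hgs.exists_bound_of_continuous hg.continuous
  have hB0 : 0 ≤ B := (norm_nonneg _).trans (hB 0)
  obtain ⟨γ, h0, hγ⟩ := exists_isIntegralCurveOn_Icc_of_lipschitzWith_of_bounded
    (f := fun t y => A t (g y)) (K := C.toNNReal * K) (L := (C * B).toNNReal) hT
    (fun t ht => ((A t).lipschitz.weaken (by
      rw [← NNReal.coe_le_coe, Real.coe_toNNReal _ hC0]; exact hC t ht)).comp hK)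
    (fun y => hA.clm_apply continuousOn_const)
    (fun t ht y => by
      rw [Real.coe_toNNReal _ (by positivity)]
      exact (A t).le_of_opNorm_le_of_le (hC t ht) (hB y)) x
  have hgn : ∀ y, ‖g y‖ ≤ ‖y‖ := fun y => by
    simp only [g, norm_smul, Real.norm_eq_abs, abs_of_nonneg χ.nonneg]
    exact mul_le_of_le_one_left (norm_nonneg _) χ.le_one
  refine ⟨γ, h0, fun t ht => ?_⟩
  have hb : ‖γ t‖ ≤ R := by
    have h := norm_le_gronwallBound_of_hasDerivWithinAt_Icc (K := C) (ε := 0) hγ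
      (by rw [h0]) (fun s hs => by
        rw [add_zero]
        exact (A s).le_of_opNorm_le_of_le (hC s hs) (hgn _)) t ht
    rw [gronwallBound_ε0] at h
    refine h.trans (le_trans ?_ (le_add_of_nonneg_right zero_le_one))
    gcongr
    exact ht.2
  have hgt : g (γ t) = γ t := by
    simp only [g]
    rw [χ.one_of_mem_closedBall (by simpa using hb), one_smul]
  have := hγ t ht
  simp only [hgt] at this
  exact this

/-- The linearisation error of a function with uniformly continuous derivative is uniformly
small. -/
theorem exists_norm_sub_fderiv_le_of_uniformContinuous {f : E → F} (hf : Differentiable ℝ f)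
    (hu : UniformContinuous (fderiv ℝ f)) {ε : ℝ} (hε : 0 < ε) :
    ∃ δ > 0, ∀ x y, ‖y - x‖ < δ → ‖f y - f x - fderiv ℝ f x (y - x)‖ ≤ ε * ‖y - x‖ := by
  obtain ⟨δ, hδ, h⟩ := Metric.uniformContinuous_iff.1 hu ε hε
  refine ⟨δ, hδ, fun x y hxy => ?_⟩
  refine (convex_ball x δ).norm_image_sub_le_of_norm_fderiv_le' (𝕜 := ℝ) (fun z _ => hf z)
    (fun z hz => ?_) (Metric.mem_ball_self hδ) (by rwa [mem_ball_iff_norm])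
  rw [← dist_eq_norm]
  exact (h hz).le

section Dependence

variable {f : E → E} {K : ℝ≥0} {φ : E → ℝ → E}

theorem norm_sub_le_of_isIntegralCurveOn (hK : LipschitzWith K f) {γ η : ℝ → E}
    (hγ : IsIntegralCurveOn γ (fun _ => f) (Icc 0 T))
    (hη : IsIntegralCurveOn η (fun _ => f) (Icc 0 T)) {t : ℝ} (ht : t ∈ Icc 0 T) :
    ‖γ t - η t‖ ≤ Real.exp (K * T) * ‖γ 0 - η 0‖ := by
  have h := norm_le_gronwallBound_of_hasDerivWithinAt_Icc (u := fun t => γ t - η t) (ε := 0)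
    (K := K) (fun t ht => (hγ t ht).sub (hη t ht)) le_rfl
    (fun t _ => by rw [add_zero]; exact hK.norm_sub_le _ _) t ht
  rw [gronwallBound_ε0, mul_comm] at h
  refine h.trans ?_
  gcongr
  exact ht.2

variable [FiniteDimensional ℝ E]

/-- The time-`T` map of a Lipschitz vector field with uniformly continuous derivative is `C¹`. -/
theorem contDiff_one_of_isIntegralCurveOn (hT : 0 ≤ T) (hf : ContDiff ℝ 1 f)
    (hK : LipschitzWith K f) (hu : UniformContinuous (fderiv ℝ f)) (h0 : ∀ x, φ x 0 = x)
    (hφ : ∀ x, IsIntegralCurveOn (φ x) (fun _ => f) (Icc 0 T)) :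
    ContDiff ℝ 1 (fun x => φ x T) := by
  have hTm : T ∈ Icc 0 T := right_mem_Icc.2 hT
  have hA : ∀ x, ContinuousOn (fun t => fderiv ℝ f (φ x t)) (Icc 0 T) := fun x =>
    (hf.continuous_fderiv one_ne_zero).comp_continuousOn (hφ x).continuousOn
  have hfK : ∀ x, ‖fderiv ℝ f x‖ ≤ K := fun x => norm_fderiv_le_of_lipschitz ℝ hK
  have hM : ∀ x, ∃ M : ℝ → E →L[ℝ] E, M 0 = ContinuousLinearMap.id ℝ E ∧
      ∀ t ∈ Icc 0 T, HasDerivWithinAt M ((fderiv ℝ f (φ x t)).comp (M t)) (Icc 0 T) t := by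
    intro x
    -- The variational equation `M' = Df(φ x t) ∘ M`, solved as a linear equation in the space of
    -- operators.
    obtain ⟨M, hM0, hM⟩ := exists_linear_ode_solution
      (A := fun t => ContinuousLinearMap.compL ℝ E E E (fderiv ℝ f (φ x t))) hT
      ((ContinuousLinearMap.compL ℝ E E E).continuous.comp_continuousOn (hA x))
      (ContinuousLinearMap.id ℝ E)
    exact ⟨M, hM0, hM⟩
  choose M hM0 hM using hM
  have hw : ∀ x y, ∀ t ∈ Icc 0 T, ‖φ y t - φ x t‖ ≤ Real.exp (K * T) * ‖y - x‖ := by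
    intro x y t ht
    have h := norm_sub_le_of_isIntegralCurveOn hK (hφ y) (hφ x) ht
    rwa [h0, h0] at h
  have hG : 0 ≤ gronwallBound 0 K 1 T := gronwallBound_zero_nonneg K.2 zero_le_one hT
  rw [contDiff_one_iff_hasFDerivAt]
  refine ⟨fun x => M x T, ?_, fun x => ?_⟩
  · refine continuous_iff_continuousAt.2 fun x => Metric.continuousAt_iff.2 fun ε hε => ?_
    obtain ⟨B, hB⟩ := isCompact_Icc.exists_bound_of_continuousOn
      (fun t ht => (hM x t ht).continuousWithinAt)
    have hB0 : 0 ≤ B := (norm_nonneg _).trans (hB 0 (left_mem_Icc.2 hT))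
    -- `gronwallBound 0 K · T` is linear in the forcing, so forcing `ε' * B` yields an error below
    -- `ε`; the `+ 1` avoids dividing by zero and makes the bound strict.
    let ε' : ℝ := ε / (B * gronwallBound 0 K 1 T + 1)
    have hε' : 0 < ε' := by positivity
    obtain ⟨δ, hδ, h⟩ := Metric.uniformContinuous_iff.1 hu ε' hε'
    refine ⟨δ / Real.exp (K * T), by positivity, fun y hy => ?_⟩
    rw [dist_eq_norm, lt_div_iff₀ (Real.exp_pos _), mul_comm] at hy
    have hb := norm_le_gronwallBound_of_hasDerivWithinAt_Icc (u := fun t => M y t - M x t)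
      (K := K) (ε := ε' * B) (δ := 0) (fun t ht => (hM y t ht).sub (hM x t ht))
      (by simp [hM0]) (fun t ht => by
        have he : (fderiv ℝ f (φ y t)).comp (M y t) - (fderiv ℝ f (φ x t)).comp (M x t) =
            (fderiv ℝ f (φ y t)).comp (M y t - M x t) +
              (fderiv ℝ f (φ y t) - fderiv ℝ f (φ x t)).comp (M x t) := by
          ext v; simp
        rw [he]
        refine (norm_add_le _ _).trans (add_le_add ?_ ?_)
        · exact (ContinuousLinearMap.opNorm_comp_le _ _).trans (by gcongr; exact hfK _)
        · refine (ContinuousLinearMap.opNorm_comp_le _ _).trans ?_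
          have := h (a := φ y t) (b := φ x t)
            (by rw [dist_eq_norm]; exact (hw x y t ht).trans_lt hy)
          rw [dist_eq_norm] at this
          gcongr
          exact hB t ht) T hTm
    rw [gronwallBound_zero_eq_mul] at hb
    rw [dist_eq_norm]
    refine hb.trans_lt ?_
    have : ε' * (B * gronwallBound 0 K 1 T + 1) = ε := div_mul_cancel₀ _ (by positivity)
    nlinarith
  · rw [hasFDerivAt_iff_isLittleO, Asymptotics.isLittleO_iff]
    intro ε hε
    let ε' : ℝ := ε / (Real.exp (K * T) * gronwallBound 0 K 1 T + 1)
    have hε' : 0 < ε' := by positivity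
    obtain ⟨δ, hδ, h⟩ := exists_norm_sub_fderiv_le_of_uniformContinuous
      (hf.differentiable one_ne_zero) hu hε'
    refine Metric.eventually_nhds_iff.2 ⟨δ / Real.exp (K * T), by positivity, fun y hy => ?_⟩
    rw [dist_eq_norm, lt_div_iff₀ (Real.exp_pos _), mul_comm] at hy
    have hb := norm_le_gronwallBound_of_hasDerivWithinAt_Icc
      (u := fun t => φ y t - φ x t - M x t (y - x))
      (K := K) (ε := ε' * (Real.exp (K * T) * ‖y - x‖)) (δ := 0)
      (fun t ht => ((hφ y t ht).sub (hφ x t ht)).sub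
        ((hM x t ht).clm_apply (hasDerivWithinAt_const t (Icc 0 T) (y - x))))
      (by simp [hM0, h0]) (fun t ht => by
        -- The remainder solves the variational equation at `x`, forced by the linearisation error
        -- of `f`. The term `M x t 0` comes from the product rule with the constant vector `y - x`.
        have he : f (φ y t) - f (φ x t) -
            (((fderiv ℝ f (φ x t)).comp (M x t)) (y - x) + M x t 0) =
            fderiv ℝ f (φ x t) (φ y t - φ x t - M x t (y - x)) +
              (f (φ y t) - f (φ x t) - fderiv ℝ f (φ x t) (φ y t - φ x t)) := by
          simp only [ContinuousLinearMap.comp_apply, map_sub, map_zero]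
          abel
        rw [he]
        refine (norm_add_le _ _).trans (add_le_add ?_ ?_)
        · exact (fderiv ℝ f (φ x t)).le_of_opNorm_le (hfK _) _
        · refine (h _ _ ((hw x y t ht).trans_lt hy)).trans ?_
          gcongr
          exact hw x y t ht) T hTm
    rw [gronwallBound_zero_eq_mul] at hb
    refine hb.trans ?_
    have : ε' * (Real.exp (K * T) * gronwallBound 0 K 1 T + 1) = ε :=
      div_mul_cancel₀ _ (by positivity)
    have h3 : 0 ≤ ε' * ‖y - x‖ := by positivity
    rw [← this]
    nlinarith

/-- Local dependence on the initial point: near the initial point of an integral curve on `[0, T]`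
of a `C¹` vector field, there are integral curves on `[0, T]`, they are Lipschitz in the initial
point, and their end points are `C¹` in the initial point. -/
theorem exists_isIntegralCurveOn_nhds (hT : 0 ≤ T) (hf : ContDiff ℝ 1 f) {γ : ℝ → E}
    (hγ : IsIntegralCurveOn γ (fun _ => f) (Icc 0 T)) :
    ∃ (φ : E → ℝ → E) (C : ℝ), ContDiff ℝ 1 (fun x => φ x T) ∧
      ∀ᶠ x in 𝓝 (γ 0), φ x 0 = x ∧ IsIntegralCurveOn (φ x) (fun _ => f) (Icc 0 T) ∧
        ∀ t ∈ Icc 0 T, ‖φ x t - γ t‖ ≤ C * ‖x - γ 0‖ := by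
  obtain ⟨R₀, hR₀⟩ := isCompact_Icc.exists_bound_of_continuousOn hγ.continuousOn
  have hR₀0 : 0 ≤ R₀ := (norm_nonneg _).trans (hR₀ 0 (left_mem_Icc.2 hT))
  -- The margin `1` lets curves starting within `exp (-(K * T))` of `γ 0` stay where the cutoff
  -- field equals `f`.
  let R : ℝ := R₀ + 1
  have hR : 0 < R := by positivity
  let χ : ContDiffBump (0 : E) := ⟨R, R + 1, hR, by linarith⟩
  let g : E → E := fun y => χ y • f y
  have hg : ContDiff ℝ 1 g := χ.contDiff.smul hf
  have hgs : HasCompactSupport g := χ.hasCompactSupport.smul_right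
  have hgf : ∀ y, ‖y‖ ≤ R → g y = f y := fun y hy => by
    simp only [g]
    rw [χ.one_of_mem_closedBall (by simpa using hy), one_smul]
  obtain ⟨K, hK⟩ := ContDiff.lipschitzWith_of_hasCompactSupport hgs hg one_ne_zero
  obtain ⟨B, hB⟩ := hgs.exists_bound_of_continuous hg.continuous
  have hB0 : 0 ≤ B := (norm_nonneg _).trans (hB 0)
  have : CompleteSpace E := FiniteDimensional.complete ℝ E
  have hex := exists_isIntegralCurveOn_Icc_of_lipschitzWith_of_bounded
    (f := fun _ => g) (K := K) (L := B.toNNReal) hT (fun _ _ => hK)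
    (fun _ => continuousOn_const)
    (fun t _ y => by rw [Real.coe_toNNReal _ hB0]; exact hB y)
  choose φ h0 hφ using hex
  have hu : UniformContinuous (fderiv ℝ g) :=
    (hgs.fderiv ℝ).uniformContinuous_of_continuous (hg.continuous_fderiv one_ne_zero)
  refine ⟨φ, Real.exp (K * T), contDiff_one_of_isIntegralCurveOn hT hg hK hu h0 hφ, ?_⟩
  have hγg : IsIntegralCurveOn γ (fun _ => g) (Icc 0 T) := fun t ht => by
    have h := hγ t ht
    simp only [← hgf (γ t) ((hR₀ t ht).trans (by simp [R]))] at h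
    exact h
  filter_upwards [Metric.ball_mem_nhds (γ 0) (Real.exp_pos (-(K * T)))] with x hx
  rw [mem_ball_iff_norm] at hx
  have hd : ∀ t ∈ Icc 0 T, ‖φ x t - γ t‖ ≤ Real.exp (K * T) * ‖x - γ 0‖ := fun t ht => by
    have h := norm_sub_le_of_isIntegralCurveOn hK (hφ x) hγg ht
    rwa [h0] at h
  have h1 : Real.exp (K * T) * ‖x - γ 0‖ ≤ 1 := by
    rw [← mul_le_mul_iff_right₀ (Real.exp_pos (-(K * T))), ← mul_assoc, ← Real.exp_add]
    simpa using hx.le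
  refine ⟨h0 x, fun t ht => ?_, hd⟩
  have hxR : ‖φ x t‖ ≤ R := by
    have h2 := norm_add_le (φ x t - γ t) (γ t)
    rw [sub_add_cancel] at h2
    linarith [hd t ht, hR₀ t ht]
  have h := hφ x t ht
  simp only [hgf _ hxR] at h
  exact h

end Dependence

end OrdinaryDifferentialEquations

/-! ### Linear algebra of phase space. -/

section PhaseSpace

variable {n : ℕ}

/-- The projection `(q, p) ↦ q` as a continuous linear map. -/
noncomputable def qPartL (n : ℕ) : Phase n →L[ℝ] Config n :=
  LinearMap.toContinuousLinearMap
    { toFun := qPart, map_add' := fun _ _ => rfl, map_smul' := fun _ _ => rfl }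

/-- The projection `(q, p) ↦ p` as a continuous linear map. -/
noncomputable def pPartL (n : ℕ) : Phase n →L[ℝ] Config n :=
  LinearMap.toContinuousLinearMap
    { toFun := pPart, map_add' := fun _ _ => rfl, map_smul' := fun _ _ => rfl }

/-- The pairing `(q, p) ↦ mkPhase q p` as a continuous linear map. -/
noncomputable def mkPhaseL (n : ℕ) : Config n × Config n →L[ℝ] Phase n :=
  LinearMap.toContinuousLinearMap
    { toFun := fun z => mkPhase z.1 z.2
      map_add' := fun a b => by ext (i | i) <;> simp [mkPhase]
      map_smul' := fun c a => by ext (i | i) <;> simp [mkPhase] }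

@[simp] theorem qPartL_apply (x : Phase n) : qPartL n x = qPart x := rfl

@[simp] theorem pPartL_apply (x : Phase n) : pPartL n x = pPart x := rfl

@[simp] theorem mkPhaseL_apply (z : Config n × Config n) : mkPhaseL n z = mkPhase z.1 z.2 := rfl

@[simp] theorem qPart_mkPhase (q p : Config n) : qPart (mkPhase q p) = q := rfl

@[simp] theorem pPart_mkPhase (q p : Config n) : pPart (mkPhase q p) = p := rfl

@[simp] theorem mkPhase_qPart_pPart (x : Phase n) : mkPhase (qPart x) (pPart x) = x := by
  ext (i | i) <;> rfl

theorem qPart_sub (x y : Phase n) : qPart (x - y) = qPart x - qPart y := rfl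

theorem pPart_sub (x y : Phase n) : pPart (x - y) = pPart x - pPart y := rfl

theorem sympJ_sub (x y : Phase n) : sympJ (x - y) = sympJ x - sympJ y := by
  ext (i | i) <;> simp [sympJ, mkPhase, qPart, pPart]; ring

theorem inner_phase (x y : Phase n) :
    inner ℝ x y = inner ℝ (qPart x) (qPart y) + inner ℝ (pPart x) (pPart y) := by
  simp [PiLp.inner_apply, qPart, pPart]

theorem norm_sq_phase (x : Phase n) : ‖x‖ ^ 2 = ‖qPart x‖ ^ 2 + ‖pPart x‖ ^ 2 := by
  simpa only [real_inner_self_eq_norm_sq] using inner_phase x x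

theorem norm_pPart_le (x : Phase n) : ‖pPart x‖ ≤ ‖x‖ :=
  le_of_sq_le_sq (by rw [norm_sq_phase x]; nlinarith [sq_nonneg ‖qPart x‖]) (norm_nonneg x)

theorem norm_sympJ (x : Phase n) : ‖sympJ x‖ = ‖x‖ := by
  have h : ‖sympJ x‖ ^ 2 = ‖x‖ ^ 2 := by
    rw [norm_sq_phase x, norm_sq_phase, sympJ, qPart_mkPhase, pPart_mkPhase, norm_neg, add_comm]
  exact (sq_eq_sq₀ (norm_nonneg _) (norm_nonneg _)).1 h

theorem norm_mkPhase_zero (p : Config n) : ‖mkPhase 0 p‖ = ‖p‖ := by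
  have h : ‖mkPhase 0 p‖ ^ 2 = ‖p‖ ^ 2 := by
    rw [norm_sq_phase, qPart_mkPhase, pPart_mkPhase, norm_zero]; ring
  exact (sq_eq_sq₀ (norm_nonneg _) (norm_nonneg _)).1 h

end PhaseSpace

/-! ### The Hamiltonian flow and its regularity. -/

section HamiltonianFlow

variable {n : ℕ} {H : Phase n → ℝ} {x y : Phase n} {t : ℝ}

theorem contDiff_gradient (hH : ContDiff ℝ 2 H) : ContDiff ℝ 1 (gradient H) :=
  (InnerProductSpace.toDual ℝ (Phase n)).symm.toContinuousLinearEquiv.contDiff.comp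
    (hH.fderiv_right (m := 1) (by norm_num))

theorem contDiff_hamField (hH : ContDiff ℝ 2 H) : ContDiff ℝ 1 (hamField H) :=
  (mkPhaseL n).contDiff.comp (((pPartL n).contDiff.comp (contDiff_gradient hH)).prodMk
    ((qPartL n).contDiff.comp (contDiff_gradient hH)).neg)

/-- `flow` chooses a trajectory separately for each time; uniqueness makes these choices agree with
any single trajectory. -/
theorem flow_eq_of_isTrajectory (hH : ContDiff ℝ 2 H) {γ : ℝ → Phase n}
    (hγ : IsTrajectory H x t γ) {s : ℝ} (hs : s ∈ Icc 0 t) : flow H s x = γ s := by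
  have h : ∃ η, IsTrajectory H x s η := ⟨γ, hγ.1, hγ.2.mono (Icc_subset_Icc_right hs.2)⟩
  rw [flow, dif_pos h]
  exact h.choose_spec.2.eqOn_Icc_of_contDiff (contDiff_hamField hH)
    (hγ.2.mono (Icc_subset_Icc_right hs.2)) (h.choose_spec.1.trans hγ.1.symm)
    (right_mem_Icc.2 hs.1)

theorem flow_zero (hH : ContDiff ℝ 2 H) (hx : x ∈ flowDomain H t) (ht : 0 ≤ t) :
    flow H 0 x = x := by
  obtain ⟨γ, hγ⟩ := hx
  rw [flow_eq_of_isTrajectory hH hγ (left_mem_Icc.2 ht), hγ.1]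

theorem isIntegralCurveOn_flow (hH : ContDiff ℝ 2 H) (hx : x ∈ flowDomain H t) :
    IsIntegralCurveOn (fun s => flow H s x) (fun _ => hamField H) (Icc 0 t) := by
  obtain ⟨γ, hγ⟩ := hx
  intro s hs
  have h := hγ.2 s hs
  rw [← flow_eq_of_isTrajectory hH hγ hs] at h
  exact h.congr (fun s hs => flow_eq_of_isTrajectory hH hγ hs)
    (flow_eq_of_isTrajectory hH hγ hs)

/-- The flow domain is a neighbourhood of each of its points, and the flow is `C¹` and locally
Lipschitz there. -/
theorem flow_dependence (hH : ContDiff ℝ 2 H) (ht : 0 ≤ t) (hx : x ∈ flowDomain H t) :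
    ContDiffAt ℝ 1 (flow H t) x ∧ ∃ C : ℝ, ∀ᶠ y in 𝓝 x, y ∈ flowDomain H t ∧
      ∀ s ∈ Icc 0 t, ‖flow H s y - flow H s x‖ ≤ C * ‖y - x‖ := by
  obtain ⟨φ, C, hφ, h⟩ := exists_isIntegralCurveOn_nhds ht (contDiff_hamField hH)
    (isIntegralCurveOn_flow hH hx)
  simp only [flow_zero hH hx ht] at h
  refine ⟨hφ.contDiffAt.congr_of_eventuallyEq ?_, C, ?_⟩
  · filter_upwards [h] with y hy
    exact flow_eq_of_isTrajectory hH ⟨hy.1, hy.2.1⟩ (right_mem_Icc.2 ht)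
  · filter_upwards [h] with y hy
    refine ⟨⟨φ y, hy.1, hy.2.1⟩, fun s hs => ?_⟩
    rw [flow_eq_of_isTrajectory hH ⟨hy.1, hy.2.1⟩ hs]
    exact hy.2.2 s hs

end HamiltonianFlow

/-! ### The action and its differential. -/

section Action

variable {n : ℕ} {H : Phase n → ℝ} {x y : Phase n} {t : ℝ}

/-- The Lagrangian `⟨p, ∂H/∂p⟩ - H` as a function on phase space. -/
noncomputable def phaseLagrangian (H : Phase n → ℝ) (x : Phase n) : ℝ :=
  inner ℝ (pPart x) (qPart (hamField H x)) - H x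

/-- The action of the trajectory on `[0, t]` that starts at `x`. -/
noncomputable def flowAction (H : Phase n → ℝ) (t : ℝ) (x : Phase n) : ℝ :=
  ∫ s in (0 : ℝ)..t, phaseLagrangian H (flow H s x)

theorem continuous_phaseLagrangian (hH : ContDiff ℝ 2 H) : Continuous (phaseLagrangian H) :=
  ((pPartL n).continuous.inner
    ((qPartL n).continuous.comp (contDiff_hamField hH).continuous)).sub hH.continuous

/-- First order Taylor estimate for a function with Lipschitz gradient. -/
theorem abs_sub_sub_inner_gradient_le (hH : Differentiable ℝ H) {s : Set (Phase n)}
    (hs : Convex ℝ s) {K : ℝ≥0} (hK : LipschitzOnWith K (gradient H) s) (hx : x ∈ s) (hy : y ∈ s) :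
    |H y - H x - inner ℝ (gradient H x) (y - x)| ≤ K * ‖y - x‖ ^ 2 := by
  have h := (convex_segment x y).norm_image_sub_le_of_norm_hasFDerivWithin_le' (𝕜 := ℝ)
    (f := H) (f' := fderiv ℝ H) (φ := fderiv ℝ H x) (C := K * ‖y - x‖)
    (fun z _ => (hH z).hasFDerivAt.hasFDerivWithinAt)
    (fun z hz => by
      have h1 := hK.norm_sub_le (hs.segment_subset hx hy hz) hx
      rw [gradient, gradient, ← map_sub, LinearIsometryEquiv.norm_map] at h1
      refine h1.trans ?_
      gcongr
      obtain ⟨a, b, ha, hb, hab, rfl⟩ := hz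
      have : a • x + b • y - x = b • (y - x) := by
        rw [eq_sub_of_add_eq hab]; module
      rw [this, norm_smul, Real.norm_eq_abs, abs_of_nonneg hb]
      exact mul_le_of_le_one_left (norm_nonneg _) (by linarith))
    (left_mem_segment ℝ x y) (right_mem_segment ℝ x y)
  rw [Real.norm_eq_abs] at h
  rw [gradient, InnerProductSpace.toDual_symm_apply]
  refine h.trans_eq ?_
  ring

/-- To first order, Hamilton's equations turn the variation of the Lagrangian into the time
derivative of `⟨p, δq⟩`. The error is `⟨δp, δ(∂H/∂p)⟩` minus the Taylor remainder of `H`, both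
quadratic. -/
theorem abs_phaseLagrangian_sub_le (hH : Differentiable ℝ H) {s : Set (Phase n)}
    (hs : Convex ℝ s) {K : ℝ≥0} (hK : LipschitzOnWith K (gradient H) s) (hx : x ∈ s) (hy : y ∈ s) :
    |phaseLagrangian H y - phaseLagrangian H x -
      (inner ℝ (pPart x) (qPart (hamField H y - hamField H x)) +
        inner ℝ (pPart (hamField H x)) (qPart (y - x)))| ≤ 2 * K * ‖y - x‖ ^ 2 := by
  have h1 := abs_sub_sub_inner_gradient_le hH hs hK hx hy
  have h2 : |inner ℝ (pPart (y - x)) (pPart (gradient H y - gradient H x))| ≤ K * ‖y - x‖ ^ 2 := by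
    refine (abs_real_inner_le_norm _ _).trans ?_
    have h3 := (norm_pPart_le _).trans (hK.norm_sub_le hy hx)
    calc _ ≤ ‖y - x‖ * (K * ‖y - x‖) := by gcongr; exact norm_pPart_le _
      _ = _ := by ring
  have h4 : phaseLagrangian H y - phaseLagrangian H x -
      (inner ℝ (pPart x) (qPart (hamField H y - hamField H x)) +
        inner ℝ (pPart (hamField H x)) (qPart (y - x))) =
      inner ℝ (pPart (y - x)) (pPart (gradient H y - gradient H x)) -
        (H y - H x - inner ℝ (gradient H x) (y - x)) := by
    rw [inner_phase (gradient H x)]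
    simp only [phaseLagrangian, hamField, sympJ, qPart_sub, pPart_sub, qPart_mkPhase,
      pPart_mkPhase, inner_sub_left, inner_sub_right, inner_neg_left,
      real_inner_comm (pPart (gradient H x))]
    ring
  rw [h4]
  refine (abs_sub _ _).trans ?_
  linarith

/-- Quadratic estimate for the variation of the action. -/
theorem exists_abs_flowAction_sub_le (hH : ContDiff ℝ 2 H) (ht : 0 ≤ t)
    (hx : x ∈ flowDomain H t) :
    ∃ C : ℝ, ∀ᶠ y in 𝓝 x, |flowAction H t y - flowAction H t x -
      (inner ℝ (pPart (flow H t x)) (qPart (flow H t y - flow H t x)) -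
        inner ℝ (pPart x) (qPart (y - x)))| ≤ C * ‖y - x‖ ^ 2 := by
  obtain ⟨-, C, hC⟩ := flow_dependence hH ht hx
  have hcx := isIntegralCurveOn_flow hH hx
  obtain ⟨R, hR⟩ := isCompact_Icc.exists_bound_of_continuousOn hcx.continuousOn
  obtain ⟨K, hK⟩ := (contDiff_gradient hH).contDiffOn.exists_lipschitzOnWith one_ne_zero
    (convex_closedBall (0 : Phase n) (R + 1)) (isCompact_closedBall _ _)
  refine ⟨2 * K * C ^ 2 * t, ?_⟩
  have hsmall : ∀ᶠ y in 𝓝 x, C * ‖y - x‖ < 1 := by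
    have : Filter.Tendsto (fun y => C * ‖y - x‖) (𝓝 x) (𝓝 (C * ‖x - x‖)) :=
      Continuous.tendsto (by fun_prop) x
    exact this.eventually_lt_const (by simp)
  filter_upwards [hC, hsmall] with y ⟨hy, hyC⟩ hy1
  have hcy := isIntegralCurveOn_flow hH hy
  -- The first-order part of the varied Lagrangian is an exact derivative, so its integral reduces
  -- to boundary terms.
  have hd : ∀ s ∈ Icc 0 t, HasDerivWithinAt
      (fun s => inner ℝ (pPart (flow H s x)) (qPart (flow H s y - flow H s x)))
      (inner ℝ (pPart (flow H s x)) (qPart (hamField H (flow H s y) - hamField H (flow H s x))) +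
        inner ℝ (pPart (hamField H (flow H s x))) (qPart (flow H s y - flow H s x)))
      (Icc 0 t) s := fun s hs =>
    ((pPartL n).hasFDerivAt.comp_hasDerivWithinAt s (hcx s hs)).inner ℝ
      ((qPartL n).hasFDerivAt.comp_hasDerivWithinAt s ((hcy s hs).sub (hcx s hs)))
  have hcf := (contDiff_hamField hH).continuous
  have hcq := (qPartL n).continuous
  have hcp := (pPartL n).continuous
  have hdc : ContinuousOn (fun s =>
      inner ℝ (pPart (flow H s x)) (qPart (hamField H (flow H s y) - hamField H (flow H s x))) +
        inner ℝ (pPart (hamField H (flow H s x))) (qPart (flow H s y - flow H s x)))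
      (Icc 0 t) :=
    ((hcp.comp_continuousOn hcx.continuousOn).inner (hcq.comp_continuousOn
      ((hcf.comp_continuousOn hcy.continuousOn).sub (hcf.comp_continuousOn hcx.continuousOn)))).add
    ((hcp.comp_continuousOn (hcf.comp_continuousOn hcx.continuousOn)).inner
      (hcq.comp_continuousOn (hcy.continuousOn.sub hcx.continuousOn)))
  have hLc := continuous_phaseLagrangian hH
  have hiy : IntervalIntegrable (fun s => phaseLagrangian H (flow H s y))
      MeasureTheory.volume 0 t := ((hLc.comp_continuousOn hcy.continuousOn).intervalIntegrable_of_Icc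
    (μ := MeasureTheory.volume) ht)
  have hix : IntervalIntegrable (fun s => phaseLagrangian H (flow H s x))
      MeasureTheory.volume 0 t := ((hLc.comp_continuousOn hcx.continuousOn).intervalIntegrable_of_Icc
    (μ := MeasureTheory.volume) ht)
  have hid := hdc.intervalIntegrable_of_Icc (μ := MeasureTheory.volume) ht
  have hftc := intervalIntegral.integral_eq_sub_of_hasDeriv_right_of_le ht
    (fun s hs => (hd s hs).continuousWithinAt)
    (fun s hs => ((hd s (Ioo_subset_Icc_self hs)).Ici_of_Icc
      (Ioo_subset_Ico_self hs)).mono Ioi_subset_Ici_self) hid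
  simp only [flow_zero hH hx ht, flow_zero hH hy ht] at hftc
  rw [← hftc, flowAction, flowAction, ← intervalIntegral.integral_sub hiy hix,
    ← intervalIntegral.integral_sub (hiy.sub hix) hid]
  have hbound := intervalIntegral.norm_integral_le_of_norm_le_const (a := 0) (b := t)
    (C := 2 * K * C ^ 2 * ‖y - x‖ ^ 2)
    (f := fun s => phaseLagrangian H (flow H s y) - phaseLagrangian H (flow H s x) -
      (inner ℝ (pPart (flow H s x)) (qPart (hamField H (flow H s y) - hamField H (flow H s x))) +
        inner ℝ (pPart (hamField H (flow H s x))) (qPart (flow H s y - flow H s x))))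
    (fun s hs => by
      rw [uIoc_of_le ht] at hs
      have hs' := Ioc_subset_Icc_self hs
      have hxs := hR s hs'
      have hys := norm_le_norm_add_norm_sub' (flow H s y) (flow H s x)
      have hd := hyC s hs'
      refine (abs_phaseLagrangian_sub_le (hH.differentiable two_ne_zero)
        (convex_closedBall (0 : Phase n) (R + 1)) hK ?_ ?_).trans ?_
      · rw [mem_closedBall_zero_iff]; linarith
      · rw [mem_closedBall_zero_iff]; linarith
      · rw [mul_assoc _ (C ^ 2), ← mul_pow]
        gcongr)
  rw [sub_zero, abs_of_nonneg ht] at hbound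
  refine hbound.trans_eq ?_
  ring

/-- The differential of the action is `P dQ - p dq`. -/
theorem hasFDerivAt_flowAction (hH : ContDiff ℝ 2 H) (ht : 0 ≤ t) (hx : x ∈ flowDomain H t) :
    HasFDerivAt (flowAction H t)
      ((innerSL ℝ (pPart (flow H t x))).comp ((qPartL n).comp (fderiv ℝ (flow H t) x)) -
        (innerSL ℝ (pPart x)).comp (qPartL n)) x := by
  obtain ⟨C, hC⟩ := exists_abs_flowAction_sub_le hH ht hx
  have hflow := ((flow_dependence hH ht hx).1.differentiableAt one_ne_zero).hasFDerivAt
  have h1 : HasFDerivAt (fun y => inner ℝ (pPart (flow H t x)) (qPart (flow H t y)) -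
      inner ℝ (pPart x) (qPart y))
      ((innerSL ℝ (pPart (flow H t x))).comp ((qPartL n).comp (fderiv ℝ (flow H t) x)) -
        (innerSL ℝ (pPart x)).comp (qPartL n)) x :=
    ((innerSL ℝ (pPart (flow H t x))).hasFDerivAt.comp x
      ((qPartL n).hasFDerivAt.comp x hflow)).sub
      ((innerSL ℝ (pPart x)).hasFDerivAt.comp x (qPartL n).hasFDerivAt)
  have h2 : HasFDerivAt (fun y => flowAction H t y -
      (inner ℝ (pPart (flow H t x)) (qPart (flow H t y)) - inner ℝ (pPart x) (qPart y)))
      -- With the coefficients `P` and `p` frozen at `x`, the remainder is `O(‖y - x‖²)`, so its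
      -- derivative vanishes.
      (0 : Phase n →L[ℝ] ℝ) x := by
    rw [hasFDerivAt_iff_isLittleO]
    have hO : (fun y => flowAction H t y -
        (inner ℝ (pPart (flow H t x)) (qPart (flow H t y)) - inner ℝ (pPart x) (qPart y)) -
        (flowAction H t x -
        (inner ℝ (pPart (flow H t x)) (qPart (flow H t x)) - inner ℝ (pPart x) (qPart x))) -
        (0 : Phase n →L[ℝ] ℝ) (y - x)) =O[𝓝 x] fun y => ‖y - x‖ ^ 2 := by
      refine Asymptotics.IsBigO.of_bound C ?_
      filter_upwards [hC] with y hy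
      rw [Real.norm_eq_abs, Real.norm_eq_abs, abs_of_nonneg (sq_nonneg ‖y - x‖)]
      refine Eq.trans_le (congrArg _ ?_) hy
      simp only [qPart_sub, inner_sub_right, zero_apply]
      ring
    refine hO.trans_isLittleO ?_
    exact (Asymptotics.isLittleO_pow_sub_sub x one_lt_two)
  have h3 := h2.add h1
  rw [zero_add] at h3
  exact h3.congr_of_eventuallyEq (Filter.Eventually.of_forall fun y => by simp)

end Action

/-! ### A local inverse with a ball as target. -/

section InverseFunction

variable {E : Type*} [NormedAddCommGroup E] [NormedSpace ℝ E] [FiniteDimensional ℝ E]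

/-- The inverse function theorem, with a ball as target of the local diffeomorphism and its source
contained in a given neighbourhood. -/
theorem ContDiffAt.exists_inverse_on_ball {f : E → E} {x : E} (hf : ContDiffAt ℝ 1 f x)
    {A : E →L[ℝ] E} (hA : HasFDerivAt f A x) (hinj : Function.Injective A) {s : Set E}
    (hs : s ∈ 𝓝 x) :
    ∃ (U : Set E) (r : ℝ) (g : E → E), 0 < r ∧ x ∈ U ∧ IsOpen U ∧ U ⊆ s ∧
      f '' U = Metric.ball (f x) r ∧ ContDiffOn ℝ 1 g (Metric.ball (f x) r) ∧
      MapsTo g (Metric.ball (f x) r) U ∧ (∀ y ∈ U, g (f y) = y) ∧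
      ∀ w ∈ Metric.ball (f x) r, f (g w) = w := by
  have : CompleteSpace E := FiniteDimensional.complete ℝ E
  obtain ⟨A', rfl⟩ : ∃ A' : E ≃L[ℝ] E, A = A' :=
    ⟨(LinearEquiv.ofInjectiveEndo (A : E →ₗ[ℝ] E) hinj).toContinuousLinearEquiv, by
      ext1 v; rfl⟩
  obtain ⟨e, he, hxe, hsc⟩ : ∃ e : OpenPartialHomeomorph E E, (e : E → E) = f ∧ x ∈ e.source ∧
      ContDiffAt ℝ 1 e.symm (f x) :=
    ⟨hf.toOpenPartialHomeomorph f hA one_ne_zero, rfl,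
      hf.mem_toOpenPartialHomeomorph_source hA one_ne_zero, hf.to_localInverse hA one_ne_zero⟩
  subst he
  have hmem : ∀ᶠ w in 𝓝 (e x), e.symm w ∈ s :=
    hsc.continuousAt.eventually_mem (by rwa [e.left_inv hxe])
  obtain ⟨r, hr, hball⟩ := Metric.eventually_nhds_iff_ball.1
    ((e.open_target.eventually_mem (e.map_source hxe)).and
      ((hsc.eventually (by simp)).and hmem))
  have hgm : MapsTo e.symm (Metric.ball (e x) r) (e.source ∩ e ⁻¹' Metric.ball (e x) r) :=
    fun w hw => ⟨e.map_target (hball w hw).1, by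
      rwa [mem_preimage, e.right_inv (hball w hw).1]⟩
  refine ⟨e.source ∩ e ⁻¹' Metric.ball (e x) r, r, e.symm, hr, ⟨hxe, Metric.mem_ball_self hr⟩,
    e.isOpen_inter_preimage Metric.isOpen_ball, fun y hy => ?_, ?_,
    fun w hw => (hball w hw).2.1.contDiffWithinAt, hgm, fun y hy => e.left_inv hy.1,
    fun w hw => e.right_inv (hball w hw).1⟩
  · have h := (hball _ hy.2).2.2
    rwa [e.left_inv hy.1] at h
  · refine Subset.antisymm (by rintro _ ⟨y, hy, rfl⟩; exact hy.2) fun w hw => ?_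
    exact ⟨e.symm w, hgm hw, e.right_inv (hball w hw).1⟩

end InverseFunction

/-! ### The map `Ψ = (q, P)` and its charts. -/

section MixedMap

variable {n : ℕ} {H : Phase n → ℝ} {x : Phase n} {t : ℝ}

/-- The derivative of `Ψ = (q, P)` at `x`. -/
noncomputable def mixedDeriv (H : Phase n → ℝ) (t : ℝ) (x : Phase n) : Phase n →L[ℝ] Phase n :=
  (mkPhaseL n).comp ((qPartL n).prod ((pPartL n).comp (fderiv ℝ (flow H t) x)))

theorem mixedDeriv_apply (v : Phase n) :
    mixedDeriv H t x v = mkPhase (qPart v) (pPart (fderiv ℝ (flow H t) x v)) := rfl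

theorem contDiffAt_mixedMap (h : ContDiffAt ℝ 1 (flow H t) x) : ContDiffAt ℝ 1 (mixedMap H t) x :=
  (mkPhaseL n).contDiff.contDiffAt.comp x
    ((qPartL n).contDiff.contDiffAt.prodMk ((pPartL n).contDiff.contDiffAt.comp x h))

theorem hasFDerivAt_mixedMap (h : DifferentiableAt ℝ (flow H t) x) :
    HasFDerivAt (mixedMap H t) (mixedDeriv H t x) x :=
  (mkPhaseL n).hasFDerivAt.comp x
    ((qPartL n).hasFDerivAt.prodMk ((pPartL n).hasFDerivAt.comp x h.hasFDerivAt))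

theorem blockD_mulVec (p : Fin n → ℝ) :
    (blockD H t x).mulVec p =
      pPart (fderiv ℝ (flow H t) x (mkPhase 0 (WithLp.toLp 2 p))) := by
  have hp : mkPhase 0 (WithLp.toLp 2 p) =
      ∑ j, p j • (EuclideanSpace.single (Sum.inr j) (1 : ℝ) : Phase n) := by
    ext (i | i) <;> simp [mkPhase, Finset.sum_apply, Pi.single_apply]
  ext i
  simp [hp, map_sum, pPart, blockD, Matrix.mulVec, dotProduct, mul_comm]

/-- `D` is invertible as soon as `∂P/∂p` has trivial kernel. -/
theorem isUnit_blockD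
    (h : ∀ p : Config n, pPart (fderiv ℝ (flow H t) x (mkPhase 0 p)) = 0 → p = 0) :
    IsUnit (blockD H t x) := by
  rw [← Matrix.mulVec_injective_iff_isUnit]
  refine (injective_iff_map_eq_zero (blockD H t x).mulVecLin).2 fun p hp => ?_
  have h1 := blockD_mulVec (H := H) (t := t) (x := x) p
  rw [← Matrix.mulVecLin_apply, hp] at h1
  have h2 := h (WithLp.toLp 2 p) (WithLp.ofLp_injective 2 h1.symm)
  exact congrArg WithLp.ofLp h2

/-- The derivative of `Ψ` keeps the `q`-part, so a kernel vector has the form `(0, p)` with `D p =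
0`. -/
theorem mixedDeriv_injective
    (h : ∀ p : Config n, pPart (fderiv ℝ (flow H t) x (mkPhase 0 p)) = 0 → p = 0) :
    Function.Injective (mixedDeriv H t x) := by
  refine (injective_iff_map_eq_zero _).2 fun v hv => ?_
  rw [mixedDeriv_apply] at hv
  have hq : qPart v = 0 := congrArg qPart hv
  have hp : pPart (fderiv ℝ (flow H t) x v) = 0 := congrArg pPart hv
  rw [← mkPhase_qPart_pPart v, hq] at hp ⊢
  rw [h _ hp]
  exact (mkPhaseL n).map_zero

/-- Existence of `(q, P)`-charts with simply connected image. -/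
theorem exists_isQPChart (hH : ContDiff ℝ 2 H) (ht : 0 ≤ t) (hx : x ∈ flowDomain H t)
    (h : ∀ p : Config n, pPart (fderiv ℝ (flow H t) x (mkPhase 0 p)) = 0 → p = 0) :
    ∃ (U : Set (Phase n)) (ψ : Phase n → Phase n),
      IsQPChart H t U ψ ∧ x ∈ U ∧ IsSimplyConnected (ψ '' U) := by
  obtain ⟨hflow, C, hC⟩ := flow_dependence hH ht hx
  obtain ⟨U, r, g, hr, hxU, hU, hUdom, himage, hg, hgm, hl, hri⟩ :=
    (contDiffAt_mixedMap hflow).exists_inverse_on_ball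
      (hasFDerivAt_mixedMap (hflow.differentiableAt one_ne_zero)) (mixedDeriv_injective h)
      (hC.mono fun y hy => hy.1)
  refine ⟨U, mixedMap H t, ⟨hUdom, fun _ _ => rfl, ?_⟩, hxU, ?_⟩
  · rw [himage]
    refine ⟨hU, Metric.isOpen_ball, fun y hy => ?_, himage ▸ mapsTo_image _ _, g, hg, hgm, hl, hri⟩
    exact (contDiffAt_mixedMap (flow_dependence hH ht (hUdom hy)).1).contDiffWithinAt
  · rw [himage]
    have : ContractibleSpace (Metric.ball (mixedMap H t x) r) := Metric.contractibleSpace_ball hr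
    exact SimplyConnectedSpace.ofContractible _

end MixedMap

/-! ### Invertibility of `∂P/∂p` below the time threshold. -/

section Invertibility

variable {n : ℕ} {H : Phase n → ℝ} {K : Set (Phase n)} {x : Phase n} {t : ℝ}

theorem bddAbove_norm_hessian (hH : ContDiff ℝ 2 H) (hK : IsCompact K) :
    BddAbove ((fun y => ‖hessian H y‖) '' K) :=
  hK.bddAbove_image ((contDiff_gradient hH).continuous_fderiv one_ne_zero).norm.continuousOn

/-- If the trajectory of `x` stays in a compact set, then the Jacobian of the flow differs from
the identity by at most `exp (L t) - 1`, for every strict upper bound `L` of the norm of the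
Hessian on the compact set. -/
theorem norm_fderiv_flow_sub_id_le (hH : ContDiff ℝ 2 H) (hK : IsCompact K) (ht : 0 ≤ t)
    (hx : x ∈ flowDomain H t) (hxK : ∀ s ∈ Icc 0 t, flow H s x ∈ K) {L : ℝ}
    (hL : ∀ y ∈ K, ‖hessian H y‖ < L) :
    ‖fderiv ℝ (flow H t) x - ContinuousLinearMap.id ℝ (Phase n)‖ ≤ Real.exp (L * t) - 1 := by
  have hL0 : 0 < L := (norm_nonneg _).trans_lt (hL _ (hxK t (right_mem_Icc.2 ht)))
  have hcont : Continuous fun y => ‖hessian H y‖ :=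
    ((contDiff_gradient hH).continuous_fderiv one_ne_zero).norm
  -- `K` need not be convex and nearby trajectories may leave it; the strict bound `L` survives on a
  -- thickening, which contains the balls used for the mean value inequality.
  obtain ⟨δ, hδ, hδK⟩ := hK.exists_thickening_subset_open (isOpen_Iio.preimage hcont) hL
  obtain ⟨hflow, C, hC⟩ := flow_dependence hH ht hx
  have hcx := isIntegralCurveOn_flow hH hx
  have hder : HasFDerivAt (fun y => flow H t y - y)
      (fderiv ℝ (flow H t) x - ContinuousLinearMap.id ℝ (Phase n)) x :=
    (hflow.differentiableAt one_ne_zero).hasFDerivAt.sub (hasFDerivAt_id x)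
  refine hder.le_of_lip' (by linarith [Real.one_le_exp (mul_nonneg hL0.le ht)]) ?_
  have hsmall : ∀ᶠ y in 𝓝 x, C * ‖y - x‖ < δ := by
    have : Filter.Tendsto (fun y => C * ‖y - x‖) (𝓝 x) (𝓝 (C * ‖x - x‖)) :=
      Continuous.tendsto (by fun_prop) x
    exact this.eventually_lt_const (by simpa using hδ)
  filter_upwards [hC, hsmall] with y ⟨hy, hyC⟩ hyδ
  have hcy := isIntegralCurveOn_flow hH hy
  -- Subtracting `y - x` makes the initial value zero at the cost of the forcing `L * ‖y - x‖`; this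
  -- produces `exp (L t) - 1` rather than `exp (L t)`.
  have h := norm_le_gronwallBound_of_hasDerivWithinAt_Icc
    (u := fun s => flow H s y - flow H s x - (y - x)) (K := L) (ε := L * ‖y - x‖) (δ := 0)
    (fun s hs => ((hcy s hs).sub (hcx s hs)).sub_const (y - x))
    (by simp [flow_zero hH hx ht, flow_zero hH hy ht]) (fun s hs => by
      have h1 : ‖hamField H (flow H s y) - hamField H (flow H s x)‖ ≤
          L * ‖flow H s y - flow H s x‖ := by
        rw [hamField, hamField, ← sympJ_sub, norm_sympJ]
        refine (convex_ball (flow H s x) δ).norm_image_sub_le_of_norm_fderiv_le (𝕜 := ℝ)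
          (fun z _ => (contDiff_gradient hH).differentiable one_ne_zero z) (fun z hz => ?_)
          (Metric.mem_ball_self hδ) ?_
        · exact (hδK (Metric.mem_thickening_iff.2 ⟨_, hxK s hs, hz⟩)).le
        · rw [mem_ball_iff_norm]
          exact (hyC s hs).trans_lt hyδ
      have h2 := norm_add_le (flow H s y - flow H s x - (y - x)) (y - x)
      rw [sub_add_cancel] at h2
      refine h1.trans ?_
      rw [← mul_add]
      gcongr) t (right_mem_Icc.2 ht)
  simp only [gronwallBound_of_K_ne_0 hL0.ne'] at h
  rw [zero_mul, zero_add, mul_div_cancel_left₀ _ hL0.ne'] at h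
  rw [sub_sub_sub_comm, mul_comm]
  exact h

/-- On a forward invariant compact set, `∂P/∂p` has trivial kernel for times below the
threshold. -/
theorem fderiv_flow_block_ker (hH : ContDiff ℝ 2 H) (hKc : IsCompact K) {T : EReal}
    (hinv : ForwardInvariant H T K) (ht : 0 ≤ t) (htT : (t : EReal) < stepThreshold T (hessianSup H K))
    (hx : x ∈ K) (p : Config n) (hp : pPart (fderiv ℝ (flow H t) x (mkPhase 0 p)) = 0) :
    p = 0 := by
  have hsup : ∀ y ∈ K, ‖hessian H y‖ ≤ hessianSup H K := fun y hy =>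
    le_csSup (bddAbove_norm_hessian hH hKc) (mem_image_of_mem _ hy)
  have hL0 : 0 ≤ hessianSup H K := (norm_nonneg _).trans (hsup x hx)
  obtain ⟨htT, htL⟩ := lt_min_iff.1 htT
  have hlt : hessianSup H K * t < Real.log 2 := by
    split_ifs at htL with h0
    · rw [h0, zero_mul]
      exact Real.log_pos one_lt_two
    · rw [EReal.coe_lt_coe_iff, lt_div_iff₀ (hL0.lt_of_ne' h0)] at htL
      rwa [mul_comm]
  -- The Jacobian estimate needs a strict Hessian bound; the strict time inequality leaves room to
  -- enlarge `L_K`, even when `L_K = 0`.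
  obtain ⟨L, hLlt, hL⟩ : ∃ L, L * t < Real.log 2 ∧ hessianSup H K < L := by
    have hlim : Filter.Tendsto (fun L => L * t) (𝓝[>] hessianSup H K)
        (𝓝 (hessianSup H K * t)) :=
      (Continuous.tendsto (by fun_prop) _).mono_left nhdsWithin_le_nhds
    exact ((hlim.eventually_lt_const hlt).and self_mem_nhdsWithin).exists
  have hle : ∀ s ∈ Icc 0 t, (s : EReal) ≤ T := fun s hs =>
    (EReal.coe_le_coe_iff.2 hs.2).trans htT.le
  have hnorm := norm_fderiv_flow_sub_id_le hH hKc ht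
    ((hinv t ht htT.le).1 hx) (fun s hs => (hinv s hs.1 (hle s hs)).2 hx)
    (fun y hy => (hsup y hy).trans_lt hL)
  have hexp : Real.exp (L * t) < 2 := (Real.lt_log_iff_exp_lt two_pos).1 hLlt
  have h1 := (fderiv ℝ (flow H t) x - ContinuousLinearMap.id ℝ (Phase n)).le_of_opNorm_le hnorm
    (mkPhase 0 p)
  have h2 := (norm_pPart_le _).trans h1
  rw [_root_.sub_apply, pPart_sub, hp, zero_sub, norm_neg, ContinuousLinearMap.id_apply,
    pPart_mkPhase, norm_mkPhase_zero] at h2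
  by_contra hne
  nlinarith [norm_pos_iff.2 hne]

end Invertibility

/-! ### The generating function on a chart. -/

section GeneratingFunction

variable {n : ℕ} {H : Phase n → ℝ} {t : ℝ} {U : Set (Phase n)} {ψ : Phase n → Phase n}

theorem IsQPChart.eqOn (h : IsQPChart H t U ψ) : EqOn ψ (mixedMap H t) U := h.eq_mixedMap

theorem IsQPChart.isC1Diffeo_mixedMap (h : IsQPChart H t U ψ) :
    IsC1Diffeo (mixedMap H t) U (ψ '' U) := by
  obtain ⟨hU, hW, hψ, hm, g, hg, hgm, hl, hr⟩ := h.diffeo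
  refine ⟨hU, hW, hψ.congr fun x hx => (h.eqOn hx).symm, hm.congr h.eqOn, g, hg, hgm,
    fun x hx => ?_, fun w hw => ?_⟩
  · rw [← h.eqOn hx, hl x hx]
  · rw [← h.eqOn (hgm hw), hr w hw]

/-- `∂P/∂p` has trivial kernel on the domain of a `(q, P)`-chart. -/
theorem IsQPChart.block_ker (h : IsQPChart H t U ψ) (hH : ContDiff ℝ 2 H) (ht : 0 ≤ t)
    {x : Phase n} (hx : x ∈ U) (p : Config n)
    (hp : pPart (fderiv ℝ (flow H t) x (mkPhase 0 p)) = 0) : p = 0 := by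
  obtain ⟨hU, hW, -, hm, g, hg, -, hl, -⟩ := h.isC1Diffeo_mixedMap
  have hf := hasFDerivAt_mixedMap
    ((flow_dependence hH ht (h.subset_domain hx)).1.differentiableAt one_ne_zero)
  have hg' := ((hg.contDiffAt (hW.mem_nhds (hm hx))).differentiableAt one_ne_zero).hasFDerivAt
  -- Differentiating `g ∘ Ψ = id` shows that the derivative of `Ψ` is injective, in particular on
  -- vectors `(0, p)`.
  have hid : HasFDerivAt (g ∘ mixedMap H t) (ContinuousLinearMap.id ℝ (Phase n)) x :=
    (hasFDerivAt_id x).congr_of_eventuallyEq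
      (Filter.eventuallyEq_of_mem (hU.mem_nhds hx) fun y hy => hl y hy)
  have h1 := DFunLike.congr_fun ((hg'.comp x hf).unique hid) (mkPhase 0 p)
  rw [ContinuousLinearMap.comp_apply, mixedDeriv_apply, hp, qPart_mkPhase] at h1
  have h0 : mkPhase (0 : Config n) 0 = 0 := (mkPhaseL n).map_zero
  rw [h0, map_zero] at h1
  exact (congrArg pPart h1).symm

theorem IsQPChart.generatingHypotheses (h : IsQPChart H t U ψ) (hH : ContDiff ℝ 2 H) (ht : 0 ≤ t)
    (hW : IsSimplyConnected (ψ '' U)) : GeneratingHypotheses H t U (ψ '' U) where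
  subset_domain := h.subset_domain
  invertible _ hx := ⟨(flow_dependence hH ht (h.subset_domain hx)).1.differentiableAt one_ne_zero,
    isUnit_blockD (h.block_ker hH ht hx)⟩
  diffeo := h.isC1Diffeo_mixedMap
  simplyConnected := hW

/-- The generating function `S = ⟨Q, P⟩ - (action)` on the image of a `(q, P)`-chart. -/
theorem IsQPChart.exists_generatingFunction (h : IsQPChart H t U ψ) (hH : ContDiff ℝ 2 H)
    (ht : 0 ≤ t) :
    ∃ (p Q : Phase n → Config n) (S : Phase n → ℝ),
      ContDiffOn ℝ 1 p (ψ '' U) ∧ ContDiffOn ℝ 1 Q (ψ '' U) ∧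
      (∀ x ∈ U, p (mixedMap H t x) = pPart x ∧ Q (mixedMap H t x) = qPart (flow H t x)) ∧
      ∀ w ∈ ψ '' U, HasGradientAt S (mkPhase (p w) (Q w)) w := by
  obtain ⟨hU, hW, -, hm, g, hg, hgm, hl, hr⟩ := h.isC1Diffeo_mixedMap
  have hflow : ∀ x ∈ U, ContDiffAt ℝ 1 (flow H t) x := fun x hx =>
    (flow_dependence hH ht (h.subset_domain hx)).1
  refine ⟨fun w => pPart (g w), fun w => qPart (flow H t (g w)),
    fun w => inner ℝ (qPart (flow H t (g w))) (pPart w) - flowAction H t (g w),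
    (pPartL n).contDiff.comp_contDiffOn hg,
    (qPartL n).contDiff.comp_contDiffOn (fun w hw =>
      (hflow _ (hgm hw)).comp_contDiffWithinAt w (hg w hw)),
    fun _ hx => by simp only [hl _ hx, and_self], fun w hw => ?_⟩
  have hg' := ((hg.contDiffAt (hW.mem_nhds hw)).differentiableAt one_ne_zero).hasFDerivAt
  have hf' := ((hflow _ (hgm hw)).differentiableAt one_ne_zero).hasFDerivAt
  have hA := (hasFDerivAt_flowAction hH ht (h.subset_domain (hgm hw))).comp w hg'
  have hQ : HasFDerivAt (fun w => qPart (flow H t (g w))) _ w :=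
    (qPartL n).hasFDerivAt.comp w (hf'.comp w hg')
  have hS := (hQ.inner ℝ (pPartL n).hasFDerivAt).sub hA
  -- `Ψ` preserves `q`, hence so does its inverse `g`; thus `p dq` pulled back by `g` involves only
  -- the `q`-part of `v`.
  have hq : (qPartL n).comp (fderiv ℝ g w) = qPartL n := by
    have h1 : HasFDerivAt (fun w => qPart (g w)) ((qPartL n).comp (fderiv ℝ g w)) w :=
      (qPartL n).hasFDerivAt.comp w hg'
    refine h1.unique ((qPartL n).hasFDerivAt.congr_of_eventuallyEq ?_)
    filter_upwards [hW.mem_nhds hw] with z hz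
    have h2 := congrArg qPart (hr z hz)
    exact h2
  have hp : pPart (flow H t (g w)) = pPart w := by
    have h2 := congrArg pPart (hr w hw)
    exact h2
  rw [hasGradientAt_iff_hasFDerivAt]
  refine hS.congr_fderiv ?_
  ext1 v
  have hqv : qPart (fderiv ℝ g w v) = qPart v := DFunLike.congr_fun hq v
  rw [InnerProductSpace.toDual_apply_apply, inner_phase, qPart_mkPhase, pPart_mkPhase]
  simp only [pPartL_apply, hp, ContinuousLinearMap.sub_comp, sub_apply,
    ContinuousLinearMap.comp_apply, ContinuousLinearMap.prod_apply, qPartL_apply,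
    fderivInnerCLM_apply, coe_innerSL_apply, hqv]
  rw [real_inner_comm (pPart w)]
  ring

/-- Gradient of the type II generating function. -/
theorem hasGradientAt_typeTwo {S : Phase n → ℝ} {w v : Phase n} (hS : HasGradientAt S v w)
    (t : ℝ) :
    HasGradientAt (typeTwo S t) (t⁻¹ • (v - mkPhase (pPart w) (qPart w))) w := by
  have h1 : HasFDerivAt (fun w : Phase n => inner ℝ (qPart w) (pPart w)) _ w :=
    (qPartL n).hasFDerivAt.inner ℝ (pPartL n).hasFDerivAt
  rw [hasGradientAt_iff_hasFDerivAt] at hS ⊢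
  have h2 : HasFDerivAt (typeTwo S t) _ w := (hS.sub h1).mul_const t⁻¹
  refine h2.congr_fderiv ?_
  ext1 u
  rw [InnerProductSpace.toDual_apply_apply, real_inner_smul_left, inner_sub_left,
    inner_phase (mkPhase _ _)]
  simp only [qPartL_apply, smul_apply, sub_apply, InnerProductSpace.toDual_apply_apply,
    ContinuousLinearMap.comp_apply, ContinuousLinearMap.prod_apply, pPartL_apply,
    fderivInnerCLM_apply, smul_eq_mul, qPart_mkPhase, pPart_mkPhase]
  rw [real_inner_comm (pPart w)]
  ring

end GeneratingFunction

theorem theorem4 (n : ℕ) (H : Phase n → ℝ) (hH : ContDiff ℝ 2 H)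
    (K : Set (Phase n)) (hKne : K.Nonempty) (hKc : IsCompact K)
    (T : EReal) (hT : 0 < T) (hinv : ForwardInvariant H T K) :
    BddAbove ((fun y => ‖hessian H y‖) '' K) ∧
    ∀ ΔT : ℝ, 0 ≤ ΔT → (ΔT : EReal) < stepThreshold T (hessianSup H K) →
      -- `D(ΔT; x)` is invertible on `K`
      (∀ x ∈ K, DifferentiableAt ℝ (flow H ΔT) x ∧ IsUnit (blockD H ΔT x)) ∧
      -- every point of `K` lies in a `(q, P)`-chart with simply connected image
      (∀ x ∈ K, ∃ (U : Set (Phase n)) (ψ : Phase n → Phase n),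
        IsQPChart H ΔT U ψ ∧ x ∈ U ∧ IsSimplyConnected (ψ '' U)) ∧
      -- on every such chart meeting `K` there is a generating function
      ∀ (U : Set (Phase n)) (ψ : Phase n → Phase n),
        IsQPChart H ΔT U ψ → (U ∩ K).Nonempty → IsSimplyConnected (ψ '' U) →
        GeneratingHypotheses H ΔT U (ψ '' U) ∧
        ∃ (p Q : Phase n → Config n) (S : Phase n → ℝ),
          ContDiffOn ℝ 1 p (ψ '' U) ∧ ContDiffOn ℝ 1 Q (ψ '' U) ∧
          -- `p` and `Q` as functions of `(q, P)`
          (∀ x ∈ U, p (mixedMap H ΔT x) = pPart x ∧ Q (mixedMap H ΔT x) = qPart (flow H ΔT x)) ∧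
          -- `p = ∂S/∂q` and `Q = ∂S/∂P`
          (∀ w ∈ ψ '' U, HasGradientAt S (mkPhase (p w) (Q w)) w) ∧
          -- the generating function identity
          (0 < ΔT → ∀ x ∈ U, HasGradientAt (typeTwo S ΔT)
            (sympJT (ΔT⁻¹ • (flow H ΔT x - x))) (mixed x (flow H ΔT x))) := by

  refine ⟨bddAbove_norm_hessian hH hKc, fun ΔT h0 hlt => ?_⟩
  have hdom : K ⊆ flowDomain H ΔT := (hinv ΔT h0 (lt_min_iff.1 hlt).1.le).1
  have hker := fun x (hx : x ∈ K) => fderiv_flow_block_ker hH hKc hinv h0 hlt hx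
  refine ⟨fun x hx => ⟨(flow_dependence hH h0 (hdom hx)).1.differentiableAt one_ne_zero,
    isUnit_blockD (hker x hx)⟩, fun x hx => exists_isQPChart hH h0 (hdom hx) (hker x hx),
    fun U ψ hψ _ hsc => ⟨hψ.generatingHypotheses hH h0 hsc, ?_⟩⟩
  obtain ⟨p, Q, S, hp, hQ, hpQ, hS⟩ := hψ.exists_generatingFunction hH h0
  refine ⟨p, Q, S, hp, hQ, hpQ, hS, fun _ x hx => ?_⟩
  have h1 := hasGradientAt_typeTwo (hS (mixedMap H ΔT x) ⟨x, hx, hψ.eq_mixedMap x hx⟩) ΔT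
  rw [(hpQ x hx).1, (hpQ x hx).2] at h1
  -- At `w = (q, P)` this reads `Jᵀ(Q - q, P - p) = (p, Q) - (P, q)`, up to the factor `ΔT⁻¹`.
  have hv : sympJT (ΔT⁻¹ • (flow H ΔT x - x)) = ΔT⁻¹ • (mkPhase (pPart x) (qPart (flow H ΔT x)) -
      mkPhase (pPart (mixedMap H ΔT x)) (qPart (mixedMap H ΔT x))) := by
    ext (i | i) <;> simp [sympJT, mkPhase, mixedMap, mixed, qPart, pPart]
    ring
  rw [hv]
  exact h1
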